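/- Let $\varepsilon,\omega,b,s\in\mathbb R$ with $1+2\varepsilon\omega>0$, and let $\tilde u:\mathbb R\to\mathbb R$ be a roll solution, i.e. an even, $2\pi$-periodic $C^4$ function of $x$ alone that is a stationary solution of $$\partial_t u=-\big(1+(1+2\varepsilon\omega)\partial_x^2+\partial_y^2\big)^2u+\varepsilon^2u+bu^2-su^3 .$$ Let $\mathbb T=\mathbb R/2\pi\mathbb Z$ and, for $p\ge 0$, let $H^p(\mathbb T)=\{h\in L^2(\mathbb T):\ \|h\|_{H^p}^2:=\sum_{j\in\mathbb Z}(1+j^2)^p|\hat h(j)|^2<\infty\}$, where $\hat h(j)=\frac1{2\pi}\int_0^{2\pi}e^{-ijx}h(x)\,dx$ (complex-valued functions). For a Bloch wave vector $\sigma=(\sigma_1,\sigma_2)\in\mathbb R^2$ let $$B(\sigma)=-\big[1+(1+2\varepsilon\omega)(\partial_x+i\sigma_1)^2-\sigma_2^2\big]^2+\varepsilon^2+2b\tilde u-3s\tilde u^2,$$ an unbounded operator on $L^2(\mathbb T)$ with domain $H^4(\mathbb T)$. Then $B(\sigma)$ is the infinitesimal generator of a unique strongly continuous semigroup $(e^{tB(\sigma)})_{t\ge0}$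 of bounded operators on $L^2(\mathbb T)$, and for every $T>0$ the operator $e^{TB(\sigma)}$ maps $H^2(\mathbb T)$ into itself and its restriction $e^{TB(\sigma)}:H^2(\mathbb T)\to H^2(\mathbb T)$ is a (bounded) compact operator. -/

import Mathlib

open scoped NNReal ENNReal Topology

noncomputable section

namespace SwiftHohenberg

open MeasureTheory

/-! ### The circle, `L²` and the periodic Sobolev spaces -/

instance factTwoPiPos : Fact ((0 : ℝ) < 2 * Real.pi) := ⟨Real.two_pi_pos⟩

/-- The circle of length `2π`. -/
abbrev Torus : Type := AddCircle (2 * Real.pi)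

/-- The normalised Haar measure `dx / 2π` on the circle. -/
abbrev torusMeasure : Measure Torus := AddCircle.haarAddCircle

/-- The space `L²` of complex valued functions on the circle, with
`‖h‖² = (1 / 2π) ∫ |h|² = ∑ j, |ĥ j|²`. -/
abbrev L2T : Type := Lp ℂ 2 torusMeasure

/-- The Fourier coefficient `ĥ j = (1 / 2π) ∫ exp (- i j x) h x dx`. -/
def coeff (h : L2T) (j : ℤ) : ℂ := fourierCoeff (h : Torus → ℂ) j

theorem coeff_eq_repr (h : L2T) (j : ℤ) :
    coeff h j = (fourierBasis (T := 2 * Real.pi)).repr h j :=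
  (fourierBasis_repr h j).symm

theorem coeff_add (f g : L2T) (j : ℤ) : coeff (f + g) j = coeff f j + coeff g j := by
  simp [coeff_eq_repr]

theorem coeff_smul (c : ℂ) (f : L2T) (j : ℤ) : coeff (c • f) j = c * coeff f j := by
  simp [coeff_eq_repr]

theorem coeff_zero (j : ℤ) : coeff 0 j = 0 := by
  simp [coeff_eq_repr]

theorem coeff_injective {f g : L2T} (h : ∀ j, coeff f j = coeff g j) : f = g := by
  apply (fourierBasis (T := 2 * Real.pi)).repr.injective
  ext j
  simpa [coeff_eq_repr] using h j

/-- The Sobolev space of order `p`, as a subspace of `L²`: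
all `h` with `∑ j, (1 + j²) ^ p * |ĥ j|² < ∞`. -/
def sobolev (p : ℕ) : Submodule ℂ L2T where
  carrier := {h | Summable fun j : ℤ => (1 + (j : ℝ) ^ 2) ^ p * ‖coeff h j‖ ^ 2}
  zero_mem' := by simp [coeff_zero, summable_zero]
  add_mem' := by
    intro f g hf hg
    have hfg := (hf.mul_left 2).add (hg.mul_left 2)
    refine Summable.of_nonneg_of_le (fun j => by positivity) (fun j => ?_) hfg
    have h1 : ‖coeff (f + g) j‖ ^ 2 ≤ 2 * ‖coeff f j‖ ^ 2 + 2 * ‖coeff g j‖ ^ 2 := by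
      rw [coeff_add]
      have h2 := norm_add_le (coeff f j) (coeff g j)
      have h3 := norm_nonneg (coeff f j + coeff g j)
      nlinarith [sq_nonneg (‖coeff f j‖ - ‖coeff g j‖)]
    have h4 : (0 : ℝ) ≤ (1 + (j : ℝ) ^ 2) ^ p := by positivity
    have h5 := mul_le_mul_of_nonneg_left h1 h4
    linarith
  smul_mem' := by
    intro c f hf
    have h1 := hf.mul_left (‖c‖ ^ 2)
    refine h1.congr (fun j => ?_)
    rw [coeff_smul, norm_mul]
    ring

theorem mem_sobolev_iff {p : ℕ} {h : L2T} :
    h ∈ sobolev p ↔ Summable fun j : ℤ => (1 + (j : ℝ) ^ 2) ^ p * ‖coeff h j‖ ^ 2 :=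
  Iff.rfl

theorem sobolev_mono {p q : ℕ} (hpq : p ≤ q) : sobolev q ≤ sobolev p := by
  intro h hh
  refine Summable.of_nonneg_of_le (fun j => by positivity) (fun j => ?_) hh
  have h1 : (1 : ℝ) ≤ 1 + (j : ℝ) ^ 2 := by nlinarith [sq_nonneg (j : ℝ)]
  gcongr

/-- The Sobolev space of order `p` as a normed space of its own, with norm
`‖w‖² = ∑ j, (1 + j²) ^ p * |ŵ j|²` (see `HSobolev.norm_sq`), not the norm of `L²`. -/
def HSobolev (p : ℕ) : Type := sobolev p

namespace HSobolev

variable {p : ℕ}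

instance : AddCommGroup (HSobolev p) := inferInstanceAs (AddCommGroup (sobolev p))

instance : Module ℂ (HSobolev p) := inferInstanceAs (Module ℂ (sobolev p))

/-- The inclusion of the Sobolev space into `L²`. -/
def toL2 : HSobolev p →ₗ[ℂ] L2T := (sobolev p).subtype

theorem toL2_mem (w : HSobolev p) : toL2 w ∈ sobolev p := Subtype.property (p := (· ∈ sobolev p)) w

theorem toL2_injective : Function.Injective (toL2 (p := p)) := Subtype.val_injective

theorem memlp_weighted (w : HSobolev p) :
    Memℓp (fun j : ℤ => (Real.sqrt ((1 + (j : ℝ) ^ 2) ^ p) : ℂ) * coeff (toL2 w) j) 2 := by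
  rw [memℓp_gen_iff (by norm_num)]
  refine (mem_sobolev_iff.1 (toL2_mem w)).congr (fun j => ?_)
  have h0 : (0 : ℝ) ≤ (1 + (j : ℝ) ^ 2) ^ p := by positivity
  simp [mul_pow, Real.sq_sqrt h0, sq_abs]

/-- The map `w ↦ (√((1 + j²) ^ p) * ŵ j)_j` into `ℓ²`, which induces the Sobolev norm. -/
def weighted : HSobolev p →ₗ[ℂ] lp (fun _ : ℤ => ℂ) 2 where
  toFun w := ⟨fun j => (Real.sqrt ((1 + (j : ℝ) ^ 2) ^ p) : ℂ) * coeff (toL2 w) j,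
    memlp_weighted w⟩
  map_add' v w := by
    ext j
    rw [lp.coeFn_add, Pi.add_apply]
    simp [coeff_add, mul_add]
  map_smul' c w := by
    ext j
    rw [lp.coeFn_smul, Pi.smul_apply]
    simp [coeff_smul]
    ring

theorem weighted_apply (w : HSobolev p) (j : ℤ) :
    weighted w j = (Real.sqrt ((1 + (j : ℝ) ^ 2) ^ p) : ℂ) * coeff (toL2 w) j := rfl

theorem weighted_injective : Function.Injective (weighted (p := p)) := by
  intro v w h
  apply toL2_injective
  apply coeff_injective
  intro j
  have h1 : weighted v j = weighted w j := by rw [h]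
  rw [weighted_apply, weighted_apply] at h1
  have h2 : (0 : ℝ) < (1 + (j : ℝ) ^ 2) ^ p := by positivity
  have h3 : (Real.sqrt ((1 + (j : ℝ) ^ 2) ^ p) : ℂ) ≠ 0 := by
    exact_mod_cast (Real.sqrt_pos.2 h2).ne'
  exact mul_left_cancel₀ h3 h1

instance : NormedAddCommGroup (HSobolev p) :=
  NormedAddCommGroup.induced (HSobolev p) (lp (fun _ : ℤ => ℂ) 2) weighted weighted_injective

instance : NormedSpace ℂ (HSobolev p) :=
  NormedSpace.induced ℂ (HSobolev p) (lp (fun _ : ℤ => ℂ) 2) weighted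

theorem norm_sq (w : HSobolev p) :
    ‖w‖ ^ 2 = ∑' j : ℤ, (1 + (j : ℝ) ^ 2) ^ p * ‖coeff (toL2 w) j‖ ^ 2 := by
  have h1 : ‖w‖ = ‖weighted w‖ := rfl
  have h2 : ‖weighted w‖ ^ 2 = ∑' j : ℤ, ‖weighted w j‖ ^ 2 := by
    have h3 := lp.norm_rpow_eq_tsum (p := 2) (by norm_num) (weighted w)
    simpa using h3
  rw [h1, h2]
  refine tsum_congr (fun j => ?_)
  have h0 : (0 : ℝ) ≤ (1 + (j : ℝ) ^ 2) ^ p := by positivity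
  rw [weighted_apply]
  simp [mul_pow, Real.sq_sqrt h0, sq_abs]

end HSobolev

/-! ### Differentiation -/

theorem memlp_deriv {p : ℕ} (u : sobolev (p + 1)) :
    Memℓp (fun j : ℤ => Complex.I * (j : ℂ) * coeff (u : L2T) j) 2 := by
  rw [memℓp_gen_iff (by norm_num)]
  refine Summable.of_nonneg_of_le (fun j => by positivity) (fun j => ?_)
    (mem_sobolev_iff.1 (sobolev_mono (Nat.le_add_left 1 p) u.2))
  simp only [norm_mul, Complex.norm_I, one_mul, Complex.norm_intCast, ENNReal.toReal_ofNat,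
    Real.rpow_ofNat, mul_pow, sq_abs, pow_one]
  nlinarith [sq_nonneg ‖coeff (u : L2T) j‖]

/-- The (weak) derivative of `u`, the element of `L²` with Fourier coefficients `i j û j`. -/
def derivL2 {p : ℕ} (u : sobolev (p + 1)) : L2T :=
  (fourierBasis (T := 2 * Real.pi)).repr.symm
    ⟨fun j : ℤ => Complex.I * (j : ℂ) * coeff (u : L2T) j, memlp_deriv u⟩

theorem coeff_derivL2 {p : ℕ} (u : sobolev (p + 1)) (j : ℤ) :
    coeff (derivL2 u) j = Complex.I * (j : ℂ) * coeff (u : L2T) j := by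
  rw [coeff_eq_repr, derivL2, LinearIsometryEquiv.apply_symm_apply]

theorem derivL2_mem {p : ℕ} (u : sobolev (p + 1)) : derivL2 u ∈ sobolev p := by
  refine Summable.of_nonneg_of_le (fun j => by positivity) (fun j => ?_) (mem_sobolev_iff.1 u.2)
  have h1 : (0 : ℝ) ≤ (1 + (j : ℝ) ^ 2) ^ p * ‖coeff (u : L2T) j‖ ^ 2 := by positivity
  rw [coeff_derivL2]
  simp only [norm_mul, Complex.norm_I, one_mul, Complex.norm_intCast, mul_pow, sq_abs]
  have h2 : (1 + (j : ℝ) ^ 2) ^ (p + 1) * ‖coeff (u : L2T) j‖ ^ 2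
      = (1 + (j : ℝ) ^ 2) ^ p * ((j : ℝ) ^ 2 * ‖coeff (u : L2T) j‖ ^ 2)
        + (1 + (j : ℝ) ^ 2) ^ p * ‖coeff (u : L2T) j‖ ^ 2 := by ring
  linarith

/-- The derivative `∂ₓ : H^(p+1) → H^p`. -/
def dx (p : ℕ) : sobolev (p + 1) →ₗ[ℂ] sobolev p where
  toFun u := ⟨derivL2 u, derivL2_mem u⟩
  map_add' u v := by
    apply Subtype.ext
    apply coeff_injective
    intro j
    simp [coeff_derivL2, coeff_add, mul_add]
  map_smul' c u := by
    apply Subtype.ext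
    apply coeff_injective
    intro j
    simp [coeff_derivL2, coeff_smul]
    ring

/-- The inclusion `H^q → H^p` for `p ≤ q`. -/
def incl {p q : ℕ} (hpq : p ≤ q) : sobolev q →ₗ[ℂ] sobolev p :=
  Submodule.inclusion (sobolev_mono hpq)

/-- The operator `Dₓ = ∂ₓ + i σ₁ : H^(p+1) → H^p`. -/
def covDeriv (σ₁ : ℝ) (p : ℕ) : sobolev (p + 1) →ₗ[ℂ] sobolev p :=
  dx p + (Complex.I * (σ₁ : ℂ)) • incl (Nat.le_succ p)

/-! ### Roll solutions -/

/-- The operator `v ↦ v + (1 + 2 ε ω) v''` on functions of the line. -/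
def rollRoot (ε ω : ℝ) (v : ℝ → ℝ) (x : ℝ) : ℝ :=
  v x + (1 + 2 * ε * ω) * iteratedDeriv 2 v x

/-- A roll solution: a real valued, `2π`-periodic, even, classical stationary solution of
`∂ₜ u = -(1 + (1 + 2 ε ω) ∂ₓ² + ∂_y²)² u + ε² u + b u² - s u³` which depends on `x` only. -/
structure Roll (ε ω b s : ℝ) where
  toFun : ℝ → ℝ
  contDiff : ContDiff ℝ 4 toFun
  periodic : Function.Periodic toFun (2 * Real.pi)
  even : ∀ x, toFun (-x) = toFun x
  stationary : ∀ x,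
    -(rollRoot ε ω (rollRoot ε ω toFun) x)
      + ε ^ 2 * toFun x + b * toFun x ^ 2 - s * toFun x ^ 3 = 0

namespace Roll

variable {ε ω b s : ℝ}

/-- The potential `ε² + 2 b ũ - 3 s ũ²`, as a function on the line. -/
def potentialFun (u : Roll ε ω b s) (x : ℝ) : ℂ :=
  ((ε ^ 2 + 2 * b * u.toFun x - 3 * s * u.toFun x ^ 2 : ℝ) : ℂ)

theorem potentialFun_periodic (u : Roll ε ω b s) :
    Function.Periodic u.potentialFun (2 * Real.pi) := by
  intro x
  simp only [potentialFun, u.periodic x]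

theorem potentialFun_continuous (u : Roll ε ω b s) : Continuous u.potentialFun := by
  have h := u.contDiff.continuous
  unfold potentialFun
  fun_prop

/-- The potential `ε² + 2 b ũ - 3 s ũ²`, as a continuous function on the circle. -/
def potential (u : Roll ε ω b s) : C(Torus, ℂ) where
  toFun := u.potentialFun_periodic.lift
  continuous_toFun := continuous_coinduced_dom.mpr u.potentialFun_continuous

theorem potential_coe (u : Roll ε ω b s) (x : ℝ) :
    u.potential (x : Torus) = ((ε ^ 2 + 2 * b * u.toFun x - 3 * s * u.toFun x ^ 2 : ℝ) : ℂ) :=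
  rfl

end Roll

/-! ### The Bloch operator -/

/-- Multiplication by a continuous function, as a bounded operator on `L²`. -/
def mulOp (F : C(Torus, ℂ)) : L2T →L[ℂ] L2T :=
  (ContinuousLinearMap.mul ℂ ℂ).holderL torusMeasure ∞ 2 2
    (ContinuousMap.toLp ∞ torusMeasure ℂ F)

theorem coeFn_mulOp (F : C(Torus, ℂ)) (h : L2T) :
    (mulOp F h : Torus → ℂ) =ᵐ[torusMeasure] fun x => F x * h x := by
  have h1 := (ContinuousLinearMap.mul ℂ ℂ).coeFn_holder (r := 2)
    (ContinuousMap.toLp ∞ torusMeasure ℂ F) h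
  have h2 := ContinuousMap.coeFn_toLp (p := ∞) (𝕜 := ℂ) torusMeasure F
  filter_upwards [h1, h2] with x hx1 hx2
  simp only [mulOp, ContinuousLinearMap.holderL_apply_apply]
  rw [hx1, hx2, ContinuousLinearMap.mul_apply']

/-- The operator `1 + (1 + 2 ε ω) (∂ₓ + i σ₁)² - σ₂² : H^(p+2) → H^p`. -/
def blochRoot (ε ω : ℝ) (σ : ℝ × ℝ) (p : ℕ) : sobolev (p + 2) →ₗ[ℂ] sobolev p :=
  incl (Nat.le_add_right p 2)
    + ((1 + 2 * ε * ω : ℝ) : ℂ) • (covDeriv σ.1 p ∘ₗ covDeriv σ.1 (p + 1))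
    - ((σ.2 ^ 2 : ℝ) : ℂ) • incl (Nat.le_add_right p 2)

/-- The Bloch operator
`B(σ) = -[1 + (1 + 2 ε ω) (∂ₓ + i σ₁)² - σ₂²]² + ε² + 2 b ũ - 3 s ũ²`,
an unbounded operator on `L²` with domain `H⁴`. -/
def blochOperator {ε ω b s : ℝ} (u : Roll ε ω b s) (σ : ℝ × ℝ) : L2T →ₗ.[ℂ] L2T where
  domain := sobolev 4
  toFun := -((sobolev 0).subtype ∘ₗ blochRoot ε ω σ 0 ∘ₗ blochRoot ε ω σ 2)
    + (mulOp u.potential : L2T →ₗ[ℂ] L2T) ∘ₗ (sobolev 4).subtype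

/-! ### Strongly continuous semigroups -/

/-- `S` is a strongly continuous one-parameter semigroup of bounded operators on `X`. -/
structure IsC0Semigroup {X : Type*} [NormedAddCommGroup X] [NormedSpace ℂ X]
    (S : ℝ≥0 → X →L[ℂ] X) : Prop where
  map_zero : S 0 = ContinuousLinearMap.id ℂ X
  map_add : ∀ t r : ℝ≥0, S (t + r) = (S t).comp (S r)
  tendsto_zero : ∀ x : X, Filter.Tendsto (fun t : ℝ≥0 => S t x) (𝓝[>] 0) (𝓝 x)

/-- `S = (e^{tA})_{t ≥ 0}`: `S` is a strongly continuous semigroup whose infinitesimal generator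
is `A`, that is, `x` lies in the domain of `A` and `A x = y` exactly when
`(S t x - x) / t → y` as `t → 0+`. -/
structure IsSemigroupGeneratedBy {X : Type*} [NormedAddCommGroup X] [NormedSpace ℂ X]
    (S : ℝ≥0 → X →L[ℂ] X) (A : X →ₗ.[ℂ] X) : Prop where
  isC0Semigroup : IsC0Semigroup S
  generator : ∀ x y : X, (x, y) ∈ A.graph ↔
    Filter.Tendsto (fun t : ℝ≥0 => ((t : ℝ) : ℂ)⁻¹ • (S t x - x)) (𝓝[>] 0) (𝓝 y)

end SwiftHohenberg

end

/-! On the Fourier side `B(σ)` is the diagonal operator with entries `-m(j)²`, where `m` is a real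
quadratic symbol, plus multiplication by a real continuous function, a bounded self-adjoint operator
`V`. For `μ = ‖V‖ + 1` the resolvent `R = (μ - B)⁻¹` exists by a Neumann series and is bounded,
nonnegative and injective (`exists_perturbed_resolvent`).

The semigroup is then a continuous function of the bounded operator `R`: `r ↦ exp (t (μ - 1 / r))`,
extended by `0` at `r = 0`, is continuous on the spectrum of `R` for `t > 0`. The semigroup law
holds pointwise, and the generator is found by testing on the dense range of `R`. Uniqueness is an
energy estimate: `Re ⟨x, B x⟩ ≤ μ ‖x‖²`, so Grönwall forces two orbits with the same initial value
to coincide.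

For compactness, `r⁻¹ exp (-t / r)` is still continuous at `0`, so `e^{TB} = R Q` with `Q` bounded
(`exists_resolventSemigroup_eq_comp`). Moreover `R = R₀ P`, with `R₀` the resolvent of the diagonal
part. Ellipticity (`exists_sq_le_blochSymbol`) makes `R₀` compact from `L²` to `H²`, and compactness
survives composition with bounded operators. -/

namespace SwiftHohenberg

open Filter

/-! ### Semigroups from the continuous functional calculus of a resolvent -/

section Existence

variable {H : Type*} [NormedAddCommGroup H] [InnerProductSpace ℂ H] [CompleteSpace H]

/-- Only an upper bound on `s` is available in the application: the exponent `t (μ - 1 / x)` is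
unbounded below as `x → 0`. -/
theorem abs_exp_sub_one_le {s c : ℝ} (hs : s ≤ c) (hc : 0 ≤ c) :
    |Real.exp s - 1| ≤ |s| * Real.exp c := by
  have hexp : (1 : ℝ) ≤ Real.exp c := Real.one_le_exp hc
  rcases le_total 0 s with h | h
  · rw [abs_of_nonneg (by linarith [Real.one_le_exp h]), abs_of_nonneg h]
    have h1 := Real.add_one_le_exp (-s)
    have h2 : Real.exp s * Real.exp (-s) = 1 := by rw [← Real.exp_add]; simp
    have h3 := Real.exp_le_exp.2 hs
    have h4 := Real.exp_pos s
    nlinarith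
  · rw [abs_of_nonpos (by linarith [Real.exp_le_one_iff.2 h]), abs_of_nonpos h]
    have h1 := Real.add_one_le_exp s
    nlinarith

theorem abs_exp_sub_one_sub_id_le {s c : ℝ} (hs : s ≤ c) (hc : 0 ≤ c) :
    |Real.exp s - 1 - s| ≤ s ^ 2 * Real.exp c := by
  have hexp : (1 : ℝ) ≤ Real.exp c := Real.one_le_exp hc
  have h1 := Real.add_one_le_exp (-s)
  have h2 : Real.exp s * Real.exp (-s) = 1 := by rw [← Real.exp_add]; simp
  have h4 := Real.exp_pos s
  have h5 : Real.exp s * (1 - s) ≤ 1 := by nlinarith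
  rw [abs_of_nonneg (by linarith [Real.add_one_le_exp s])]
  rcases le_total 0 s with h | h
  · have h3 := Real.exp_le_exp.2 hs
    have h6 : Real.exp s - 1 ≤ s * Real.exp s := by linarith
    have h7 : s * (Real.exp s - 1) ≤ s * (s * Real.exp s) := mul_le_mul_of_nonneg_left h6 h
    have h8 : s ^ 2 * Real.exp s ≤ s ^ 2 * Real.exp c :=
      mul_le_mul_of_nonneg_left h3 (sq_nonneg s)
    nlinarith
  · have h6 : Real.exp s - 1 - s ≤ s ^ 2 := by nlinarith [sq_nonneg s]
    nlinarith [sq_nonneg s]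

/-- The function `r ↦ exp (t (μ - 1 / r))` for `r > 0`, extended by `0`. -/
noncomputable def expInv (μ t r : ℝ) : ℝ := Real.exp (t * μ) * expNegInvGlue (r / t)

theorem expInv_of_pos {μ t r : ℝ} (ht : 0 < t) (hr : 0 < r) :
    expInv μ t r = Real.exp (t * (μ - r⁻¹)) := by
  rw [expInv, expNegInvGlue, if_neg (not_le.2 (div_pos hr ht)), ← Real.exp_add]
  congr 1
  field_simp
  ring

theorem expInv_zero (μ t : ℝ) : expInv μ t 0 = 0 := by simp [expInv]

/-- Continuity at `0` is what makes the functional calculus applicable although `0` may lie in the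
spectrum of `R`. -/
theorem continuous_expInv (μ t : ℝ) : Continuous (expInv μ t) := by
  have h : Continuous expNegInvGlue := (expNegInvGlue.contDiff (n := 0)).continuous
  unfold expInv
  fun_prop

theorem expInv_add {μ t r x : ℝ} (ht : 0 < t) (hr : 0 < r) (hx : 0 ≤ x) :
    expInv μ (t + r) x = expInv μ t x * expInv μ r x := by
  rcases hx.eq_or_lt with rfl | hx
  · simp [expInv_zero]
  · rw [expInv_of_pos (by positivity) hx, expInv_of_pos ht hx, expInv_of_pos hr hx,
      ← Real.exp_add]
    ring_nf

theorem abs_expInv_le {μ t x : ℝ} (hμ : 0 ≤ μ) (ht : 0 < t) (ht1 : t ≤ 1) (hx : 0 ≤ x) :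
    |expInv μ t x| ≤ Real.exp μ := by
  rcases hx.eq_or_lt with rfl | hx
  · simp [expInv_zero, Real.exp_nonneg]
  · rw [expInv_of_pos ht hx, abs_of_nonneg (Real.exp_nonneg _), Real.exp_le_exp]
    have : 0 < x⁻¹ := by positivity
    nlinarith

theorem expInv_exponent_le {μ t x : ℝ} (hμ : 0 ≤ μ) (ht : 0 < t) (ht1 : t ≤ 1) (hx : 0 < x) :
    t * (μ - x⁻¹) ≤ μ := by
  have : 0 < x⁻¹ := by positivity
  nlinarith

/-- The factor `x` turns the unbounded `μ - 1 / x` into `μ x - 1`, so the bound is uniform in `t`. A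
second factor `x`, in `abs_expInv_remainder_le`, absorbs the quadratic Taylor remainder and leaves a
factor `t`. -/
theorem abs_expInv_sub_one_mul_le {μ t x : ℝ} (hμ : 0 ≤ μ) (ht : 0 < t) (ht1 : t ≤ 1)
    (hx : 0 ≤ x) : |t⁻¹ * ((expInv μ t x - 1) * x)| ≤ |μ * x - 1| * Real.exp μ := by
  rcases hx.eq_or_lt with rfl | hx
  · simp [Real.exp_nonneg]
  · have h1 := abs_exp_sub_one_le (expInv_exponent_le hμ ht ht1 hx) hμ
    rw [expInv_of_pos ht hx, abs_mul, abs_mul, abs_of_pos (inv_pos.2 ht), abs_of_pos hx]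
    have h2 : |t * (μ - x⁻¹)| = t * x⁻¹ * |μ * x - 1| := by
      rw [show t * (μ - x⁻¹) = t * x⁻¹ * (μ * x - 1) by field_simp, abs_mul,
        abs_of_pos (show 0 < t * x⁻¹ by positivity)]
    rw [h2] at h1
    calc t⁻¹ * (|Real.exp (t * (μ - x⁻¹)) - 1| * x)
        ≤ t⁻¹ * (t * x⁻¹ * |μ * x - 1| * Real.exp μ * x) := by gcongr
      _ = |μ * x - 1| * Real.exp μ := by field_simp

theorem abs_expInv_remainder_le {μ t x : ℝ} (hμ : 0 ≤ μ) (ht : 0 < t) (ht1 : t ≤ 1)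
    (hx : 0 ≤ x) :
    |(t⁻¹ * ((expInv μ t x - 1) * x) - (μ * x - 1)) * x| ≤ t * ((μ * x - 1) ^ 2 * Real.exp μ) := by
  rcases hx.eq_or_lt with rfl | hx
  · simp only [mul_zero, abs_zero]
    positivity
  · have h1 := abs_exp_sub_one_sub_id_le (expInv_exponent_le hμ ht ht1 hx) hμ
    rw [expInv_of_pos ht hx]
    have h2 : (t⁻¹ * ((Real.exp (t * (μ - x⁻¹)) - 1) * x) - (μ * x - 1)) * x
        = t⁻¹ * x ^ 2 * (Real.exp (t * (μ - x⁻¹)) - 1 - t * (μ - x⁻¹)) := by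
      field_simp
    rw [h2, abs_mul, abs_of_pos (show 0 < t⁻¹ * x ^ 2 by positivity)]
    calc t⁻¹ * x ^ 2 * |Real.exp (t * (μ - x⁻¹)) - 1 - t * (μ - x⁻¹)|
        ≤ t⁻¹ * x ^ 2 * ((t * (μ - x⁻¹)) ^ 2 * Real.exp μ) := by gcongr
      _ = t * ((μ * x - 1) ^ 2 * Real.exp μ) := by field_simp

omit [CompleteSpace H] in
/-- Strong convergence to zero of a bounded family of operators can be tested on the range of an
operator with dense range. -/
theorem tendsto_zero_of_denseRange {ι : Type*} {l : Filter ι} {G : ι → H →L[ℂ] H} {C : ℝ}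
    (hG : ∀ᶠ t in l, ‖G t‖ ≤ C) {R : H →L[ℂ] H} (hR : DenseRange R)
    (h : ∀ z, Tendsto (fun t => G t (R z)) l (𝓝 0)) (x : H) :
    Tendsto (fun t => G t x) l (𝓝 0) := by
  rw [Metric.tendsto_nhds]
  intro e he
  obtain ⟨z, hz⟩ := hR.exists_dist_lt x (show 0 < e / (2 * (|C| + 1)) by positivity)
  filter_upwards [hG, (Metric.tendsto_nhds.1 (h z)) (e / 2) (by positivity)] with t h1 h2
  rw [dist_zero_right] at h2 ⊢
  have h3 : G t x = G t (x - R z) + G t (R z) := by rw [← map_add, sub_add_cancel]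
  have h4 : ‖G t (x - R z)‖ ≤ (|C| + 1) * ‖x - R z‖ :=
    (G t).le_of_opNorm_le (h1.trans ((le_abs_self C).trans (by linarith))) _
  rw [dist_eq_norm] at hz
  have h5 : (|C| + 1) * ‖x - R z‖ < e / 2 := by
    calc (|C| + 1) * ‖x - R z‖ < (|C| + 1) * (e / (2 * (|C| + 1))) := by gcongr
      _ = e / 2 := by field_simp
  rw [h3]
  linarith [norm_add_le (G t (x - R z)) (G t (R z))]

/-- For self-adjoint `R` the orthogonal complement of the range is the kernel. -/
theorem denseRange_of_nonneg_of_injective {R : H →L[ℂ] H} (hR : 0 ≤ R)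
    (hinj : Function.Injective R) : DenseRange R := by
  have hsa : IsSelfAdjoint R := IsSelfAdjoint.of_nonneg hR
  have h1 : (LinearMap.range (R : H →ₗ[ℂ] H))ᗮ = ⊥ := by
    rw [ContinuousLinearMap.orthogonal_range, ← ContinuousLinearMap.star_eq_adjoint, hsa.star_eq]
    exact LinearMap.ker_eq_bot.2 hinj
  have h2 := Submodule.topologicalClosure_eq_top_iff.2 h1
  have h3 := Submodule.dense_iff_topologicalClosure_eq_top.2 h2
  exact h3

/-- The semigroup `exp (t (μ - R⁻¹))` for a nonnegative injective bounded operator `R`. -/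
noncomputable def resolventSemigroup (R : H →L[ℂ] H) (μ : ℝ) (t : ℝ≥0) : H →L[ℂ] H :=
  -- At `t = 0` the function `expInv μ t` is identically `0` because `r / 0 = 0`, so the identity
  -- has to be put in by hand.
  if t = 0 then 1 else cfc (expInv μ t) R

variable {R : H →L[ℂ] H} {μ : ℝ}

theorem resolventSemigroup_of_pos {t : ℝ≥0} (ht : 0 < t) :
    resolventSemigroup R μ t = cfc (expInv μ t) R := if_neg ht.ne'

theorem resolventSemigroup_add (hR : 0 ≤ R) (t r : ℝ≥0) :
    resolventSemigroup R μ (t + r)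
      = (resolventSemigroup R μ t).comp (resolventSemigroup R μ r) := by
  rcases eq_zero_or_pos t with rfl | ht
  · simp [resolventSemigroup, ContinuousLinearMap.one_def]
  rcases eq_zero_or_pos r with rfl | hr
  · simp [resolventSemigroup, ContinuousLinearMap.one_def]
  rw [resolventSemigroup_of_pos ht, resolventSemigroup_of_pos hr,
    resolventSemigroup_of_pos (by positivity), ← ContinuousLinearMap.mul_def,
    ← cfc_mul _ _ R (continuous_expInv _ _).continuousOn (continuous_expInv _ _).continuousOn]
  refine cfc_congr fun x hx => ?_
  push_cast
  exact expInv_add (by exact_mod_cast ht) (by exact_mod_cast hr)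
    (spectrum_nonneg_of_nonneg hR hx)

theorem commute_resolventSemigroup (t : ℝ≥0) : Commute (resolventSemigroup R μ t) R := by
  rcases eq_zero_or_pos t with rfl | ht
  · simp [resolventSemigroup]
  · rw [resolventSemigroup_of_pos ht]
    exact (Commute.refl R).cfc_real _

/-- This is the smoothing effect: `exp (-t / r)` beats `1 / r` at `0`, so one factor `r` can be
split off with a continuous quotient. -/
theorem exists_resolventSemigroup_eq_comp (hR : 0 ≤ R) {t : ℝ≥0} (ht : 0 < t) :
    ∃ Q : H →L[ℂ] H, resolventSemigroup R μ t = R.comp Q := by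
  have hsa : IsSelfAdjoint R := IsSelfAdjoint.of_nonneg hR
  have ht' : (0 : ℝ) < t := by exact_mod_cast ht
  have hc : Continuous fun r : ℝ =>
      Real.exp (t * μ) * (t : ℝ)⁻¹ * ((r / t)⁻¹ * expNegInvGlue (r / t)) := by
    have h := expNegInvGlue.continuous_polynomial_eval_inv_mul Polynomial.X
    simp only [Polynomial.eval_X] at h
    have h2 := h.comp (continuous_id.div_const (t : ℝ))
    exact continuous_const.mul h2
  refine ⟨cfc (fun r : ℝ => Real.exp (t * μ) * (t : ℝ)⁻¹ * ((r / t)⁻¹ * expNegInvGlue (r / t))) R, ?_⟩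
  rw [resolventSemigroup_of_pos ht, ← ContinuousLinearMap.mul_def]
  nth_rewrite 2 [← cfc_id' ℝ R hsa]
  rw [← cfc_mul _ _ R continuous_id'.continuousOn hc.continuousOn]
  refine cfc_congr fun x hx => ?_
  rcases (spectrum_nonneg_of_nonneg hR hx).eq_or_lt with rfl | hx
  · simp [expInv_zero]
  · simp only [expInv]
    field_simp

/-- The difference quotient of the semigroup, composed with `R`, is bounded. -/
theorem exists_norm_differenceQuotient_le (hR : 0 ≤ R) (hμ : 0 ≤ μ) :
    ∃ C : ℝ, ∀ t : ℝ≥0, 0 < t → t ≤ 1 →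
      ‖((t : ℝ)⁻¹ • ((resolventSemigroup R μ t - 1) * R) - (μ • R - 1))‖ ≤ C ∧
      ‖((t : ℝ)⁻¹ • ((resolventSemigroup R μ t - 1) * R) - (μ • R - 1)) * R‖ ≤ t * C := by
  have hsa : IsSelfAdjoint R := IsSelfAdjoint.of_nonneg hR
  -- `N` bounds the spectrum; the norm of `1` is kept because `H` may be trivial.
  set N : ℝ := ‖R‖ * ‖(1 : H →L[ℂ] H)‖
  set M : ℝ := μ * N + 1
  have hM1 : 1 ≤ M := by
    have : 0 ≤ μ * N := by positivity
    linarith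
  have hE : 1 ≤ Real.exp μ := Real.one_le_exp hμ
  refine ⟨M ^ 2 * Real.exp μ + M, fun t ht ht1 => ?_⟩
  have ht' : (0 : ℝ) < t := by exact_mod_cast ht
  have ht1' : (t : ℝ) ≤ 1 := by exact_mod_cast ht1
  have hq : Continuous fun r : ℝ => (t : ℝ)⁻¹ * ((expInv μ t r - 1) * r) - (μ * r - 1) := by
    have := continuous_expInv μ t
    fun_prop
  have heq : ((t : ℝ)⁻¹ • ((resolventSemigroup R μ t - 1) * R) - (μ • R - 1))
      = cfc (fun r : ℝ => (t : ℝ)⁻¹ * ((expInv μ t r - 1) * r) - (μ * r - 1)) R := by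
    have hf := continuous_expInv μ t
    rw [cfc_sub (fun r : ℝ => (t : ℝ)⁻¹ * ((expInv μ t r - 1) * r)) (fun r : ℝ => μ * r - 1) R
        (by fun_prop) (by fun_prop),
      cfc_const_mul _ (fun r : ℝ => (expInv μ t r - 1) * r) R (by fun_prop),
      cfc_mul (fun r : ℝ => expInv μ t r - 1) (fun r : ℝ => r) R (by fun_prop) (by fun_prop),
      cfc_sub (expInv μ t) (fun _ : ℝ => (1 : ℝ)) R (by fun_prop) (by fun_prop),
      cfc_sub (fun r : ℝ => μ * r) (fun _ : ℝ => (1 : ℝ)) R (by fun_prop) (by fun_prop),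
      cfc_const_mul μ (fun r : ℝ => r) R (by fun_prop), cfc_id' ℝ R hsa,
      cfc_const_one ℝ R hsa, resolventSemigroup_of_pos ht]
  have hbound : ∀ x ∈ spectrum ℝ R, 0 ≤ x ∧ |μ * x - 1| ≤ M := fun x hx => by
    have h0 := spectrum_nonneg_of_nonneg hR hx
    have h1 : x ≤ N := (le_abs_self x).trans (spectrum.norm_le_norm_mul_of_mem hx)
    refine ⟨h0, abs_le.2 ⟨?_, ?_⟩⟩
    · have : 0 ≤ μ * x := by positivity
      linarith
    · have : μ * x ≤ μ * N := by gcongr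
      linarith
  have hM0 : 0 ≤ M := by linarith
  rw [heq]
  constructor
  · refine norm_cfc_le (by positivity) fun x hx => ?_
    obtain ⟨h0, h1⟩ := hbound x hx
    have h2 := abs_expInv_sub_one_mul_le hμ ht' ht1' h0
    rw [Real.norm_eq_abs]
    refine (abs_sub _ _).trans (add_le_add (h2.trans ?_) h1)
    gcongr
    nlinarith
  · have h3 : cfc (fun r : ℝ => (t : ℝ)⁻¹ * ((expInv μ t r - 1) * r) - (μ * r - 1)) R * R
        = cfc (fun r : ℝ => ((t : ℝ)⁻¹ * ((expInv μ t r - 1) * r) - (μ * r - 1)) * r) R := by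
      rw [cfc_mul _ (fun r : ℝ => r) R hq.continuousOn (by fun_prop), cfc_id' ℝ R hsa]
    rw [h3]
    refine norm_cfc_le (by positivity) fun x hx => ?_
    obtain ⟨h0, h1⟩ := hbound x hx
    refine (abs_expInv_remainder_le hμ ht' ht1' h0).trans ?_
    have h4 : (μ * x - 1) ^ 2 ≤ M ^ 2 := sq_le_sq.2 (by rwa [abs_of_nonneg hM0])
    gcongr
    nlinarith [Real.exp_pos μ]

theorem eventually_pos_le_one : ∀ᶠ t : ℝ≥0 in 𝓝[>] 0, 0 < t ∧ t ≤ 1 := by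
  have h : ∀ᶠ t : ℝ≥0 in 𝓝[>] 0, t ≤ 1 :=
    mem_nhdsWithin_of_mem_nhds (Iic_mem_nhds (by norm_num))
  filter_upwards [h, self_mem_nhdsWithin] with t h1 h2 using ⟨h2, h1⟩

theorem tendsto_coe_nhdsGT_zero : Tendsto (fun t : ℝ≥0 => (t : ℝ)) (𝓝[>] 0) (𝓝 0) := by
  have h : Tendsto (fun t : ℝ≥0 => (t : ℝ)) (𝓝 0) (𝓝 0) := NNReal.continuous_coe.tendsto 0
  exact h.mono_left nhdsWithin_le_nhds

/-- Composed with `R`, the quotients minus their limit are uniformly bounded; composed with `R²`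
they are `O(t)` in norm. Density of the range of `R` removes the second factor. -/
theorem tendsto_differenceQuotient (hR : 0 ≤ R) (hinj : Function.Injective R) (hμ : 0 ≤ μ)
    (z : H) :
    Tendsto (fun t : ℝ≥0 => ((t : ℝ) : ℂ)⁻¹ • (resolventSemigroup R μ t (R z) - R z))
      (𝓝[>] 0) (𝓝 ((μ : ℂ) • R z - z)) := by
  obtain ⟨C, hC⟩ := exists_norm_differenceQuotient_le hR hμ
  have h1 := tendsto_zero_of_denseRange (l := 𝓝[>] (0 : ℝ≥0)) (C := C) (R := R)
    (G := fun t : ℝ≥0 => (t : ℝ)⁻¹ • ((resolventSemigroup R μ t - 1) * R) - (μ • R - 1))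
    (eventually_pos_le_one.mono fun t ht => (hC t ht.1 ht.2).1)
    (denseRange_of_nonneg_of_injective hR hinj) (fun v => ?_) z
  · rw [← tendsto_sub_nhds_zero_iff]
    refine h1.congr fun t => ?_
    simp [← Complex.ofReal_inv, Complex.coe_smul]
  · have h2 : Tendsto (fun t : ℝ≥0 => (t : ℝ) * C * ‖v‖) (𝓝[>] 0) (𝓝 0) := by
      simpa using (tendsto_coe_nhdsGT_zero.mul_const C).mul_const ‖v‖
    refine squeeze_zero_norm' (eventually_pos_le_one.mono fun t ht => ?_) h2
    exact ContinuousLinearMap.le_of_opNorm_le _ (hC t ht.1 ht.2).2 v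

theorem isC0Semigroup_resolventSemigroup (hR : 0 ≤ R) (hinj : Function.Injective R)
    (hμ : 0 ≤ μ) : IsC0Semigroup (resolventSemigroup R μ) where
  map_zero := by simp [resolventSemigroup, ContinuousLinearMap.one_def]
  map_add := resolventSemigroup_add hR
  tendsto_zero x := by
    have h1 := tendsto_zero_of_denseRange (l := 𝓝[>] (0 : ℝ≥0))
      (C := Real.exp μ + ‖(1 : H →L[ℂ] H)‖) (R := R)
      (G := fun t : ℝ≥0 => resolventSemigroup R μ t - 1) ?_
      (denseRange_of_nonneg_of_injective hR hinj) (fun z => ?_) x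
    · rw [← tendsto_sub_nhds_zero_iff]
      exact h1
    · refine eventually_pos_le_one.mono fun t ht => (norm_sub_le _ _).trans ?_
      gcongr
      rw [resolventSemigroup_of_pos ht.1]
      exact norm_cfc_le (Real.exp_nonneg _) fun x hx =>
        abs_expInv_le hμ ht.1 ht.2 (spectrum_nonneg_of_nonneg hR hx)
    -- On the range of `R` the increment is `t` times a convergent difference quotient.
    · have h2 := (Complex.continuous_ofReal.tendsto 0).comp tendsto_coe_nhdsGT_zero
      have h3 := h2.smul (tendsto_differenceQuotient hR hinj hμ z)
      rw [Complex.ofReal_zero, zero_smul] at h3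
      refine h3.congr' (eventually_pos_le_one.mono fun t ht => ?_)
      have ht' : ((t : ℝ) : ℂ) ≠ 0 := by exact_mod_cast ht.1.ne'
      simp [smul_smul, mul_inv_cancel₀ ht']

/-- If `R = (μ - A)⁻¹` is a nonnegative bounded operator, then `A` generates the semigroup
`exp (t (μ - R⁻¹))`. -/
theorem isSemigroupGeneratedBy_resolventSemigroup (hR : 0 ≤ R) (hinj : Function.Injective R)
    (hμ : 0 ≤ μ) {A : H →ₗ.[ℂ] H}
    (hA : ∀ x y, (x, y) ∈ A.graph ↔ R ((μ : ℂ) • x - y) = x) :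
    IsSemigroupGeneratedBy (resolventSemigroup R μ) A where
  isC0Semigroup := isC0Semigroup_resolventSemigroup hR hinj hμ
  generator x y := by
    rw [hA]
    constructor
    · intro h
      have h1 := tendsto_differenceQuotient hR hinj hμ ((μ : ℂ) • x - y)
      rw [h] at h1
      simpa only [sub_sub_cancel] using h1
    -- Applying `R`, which commutes with the semigroup, to the limit gives `R y = μ R x - x`, the
    -- resolvent equation.
    · intro h
      have h1 := (R.continuous.tendsto y).comp h
      have h2 := tendsto_differenceQuotient hR hinj hμ x
      have h3 := tendsto_nhds_unique (h2.congr fun t => ?_) h1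
      · rw [map_sub, map_smul, ← h3]
        simp
      · have h4 : resolventSemigroup R μ t (R x) = R (resolventSemigroup R μ t x) :=
          DFunLike.congr_fun (commute_resolventSemigroup (R := R) (μ := μ) t).eq x
        simp [h4]

end Existence

end SwiftHohenberg

namespace SwiftHohenberg

open Filter

/-! ### Orbits of strongly continuous semigroups -/

section Uniqueness

variable {X : Type*} [NormedAddCommGroup X] [NormedSpace ℂ X] {S : ℝ≥0 → X →L[ℂ] X}

theorem IsC0Semigroup.tendsto_nhds_zero (hS : IsC0Semigroup S) (x : X) :
    Tendsto (fun t => S t x) (𝓝 0) (𝓝 x) := by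
  have h0 : S 0 x = x := by rw [hS.map_zero]; rfl
  have h1 : Tendsto (fun t => S t x) (pure 0) (𝓝 x) := by
    rw [tendsto_pure_left]
    intro s hs
    rw [h0]
    exact mem_of_mem_nhds hs
  have h2 := h1.sup (hS.tendsto_zero x)
  have h3 : insert (0 : ℝ≥0) (Set.Ioi 0) = Set.univ := by
    ext t
    simp only [Set.mem_insert_iff, Set.mem_Ioi, Set.mem_univ, iff_true]
    exact eq_zero_or_pos t
  rwa [← nhdsWithin_insert, h3, nhdsWithin_univ] at h2

/-- Otherwise some `t n → 0` has `‖S (t n)‖ > n`, while every orbit converges along `t n`, against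
Banach–Steinhaus. -/
theorem IsC0Semigroup.exists_norm_le_near_zero [CompleteSpace X] (hS : IsC0Semigroup S) :
    ∃ M : ℝ, ∃ δ : ℝ≥0, 0 < δ ∧ ∀ t ≤ δ, ‖S t‖ ≤ M := by
  by_contra! hcon
  choose t ht hlarge using fun n : ℕ => hcon n (1 / ((n : ℝ≥0) + 1)) (by positivity)
  have ht0 : Tendsto t atTop (𝓝 0) := by
    refine tendsto_of_tendsto_of_tendsto_of_le_of_le tendsto_const_nhds ?_ (fun n => zero_le) ht
    exact tendsto_one_div_add_atTop_nhds_zero_nat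
  obtain ⟨C, hC⟩ := banach_steinhaus (g := fun n => S (t n)) fun x => by
    obtain ⟨C, hC⟩ := ((hS.tendsto_nhds_zero x).comp ht0).norm.bddAbove_range
    exact ⟨C, fun n => hC ⟨n, rfl⟩⟩
  obtain ⟨n, hn⟩ := exists_nat_gt C
  linarith [hC n, hlarge n]

theorem IsC0Semigroup.exists_norm_le [CompleteSpace X] (hS : IsC0Semigroup S) (b : ℝ≥0) :
    ∃ M : ℝ, 0 ≤ M ∧ ∀ t ≤ b, ‖S t‖ ≤ M := by
  obtain ⟨M, δ, hδ, hM⟩ := hS.exists_norm_le_near_zero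
  have hM0 : 0 ≤ M := (norm_nonneg _).trans (hM 0 zero_le)
  have key : ∀ n : ℕ, ∃ C : ℝ, 0 ≤ C ∧ ∀ t ≤ n * δ, ‖S t‖ ≤ C := by
    intro n
    induction n with
    | zero =>
      refine ⟨M, hM0, fun t ht => hM t (ht.trans ?_)⟩
      simp
    | succ n ih =>
      obtain ⟨C, hC0, hC⟩ := ih
      refine ⟨max M (M * C), le_max_of_le_left hM0, fun t ht => ?_⟩
      rcases le_total t δ with h | h
      · exact (hM t h).trans (le_max_left _ _)
      · have h1 : t = δ + (t - δ) := (add_tsub_cancel_of_le h).symm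
        rw [h1, hS.map_add]
        refine (ContinuousLinearMap.opNorm_comp_le _ _).trans (le_max_of_le_right ?_)
        refine mul_le_mul (hM δ le_rfl) (hC _ ?_) (norm_nonneg _) hM0
        rw [tsub_le_iff_right]
        push_cast at ht
        linarith
  obtain ⟨n, hn⟩ := exists_nat_ge (b / δ)
  obtain ⟨C, hC0, hC⟩ := key n
  exact ⟨C, hC0, fun t ht => hC t (ht.trans ((div_le_iff₀ hδ).1 hn))⟩

theorem IsC0Semigroup.continuous_orbit [CompleteSpace X] (hS : IsC0Semigroup S) (x : X) :
    Continuous fun t => S t x := by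
  rw [continuous_iff_continuousAt]
  intro a
  obtain ⟨M, hM0, hM⟩ := hS.exists_norm_le (a + 1)
  have h1 : Tendsto (fun t : ℝ≥0 => M * ‖S (max t a - min t a) x - x‖) (𝓝 a) (𝓝 0) := by
    have h2 : Tendsto (fun t : ℝ≥0 => max t a - min t a) (𝓝 a) (𝓝 0) := by
      have h3 : Continuous fun t : ℝ≥0 => max t a - min t a := by fun_prop
      simpa using h3.tendsto a
    have h4 := (((hS.tendsto_nhds_zero x).comp h2).sub_const x).norm.const_mul M
    simpa using h4
  rw [ContinuousAt, tendsto_iff_norm_sub_tendsto_zero]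
  refine squeeze_zero' (Eventually.of_forall fun t => norm_nonneg _) ?_ h1
  filter_upwards [Iic_mem_nhds (show a < a + 1 by simp)] with t ht
  -- Factoring out the operator at the earlier time handles left and right continuity together.
  have h5 : ∀ p q : ℝ≥0, p ≤ q → q ≤ a + 1 → ‖S q x - S p x‖ ≤ M * ‖S (q - p) x - x‖ := by
    intro p q hpq hq
    have h6 : S q x - S p x = S p (S (q - p) x - x) := by
      conv_lhs => rw [← add_tsub_cancel_of_le hpq, hS.map_add]
      simp
    rw [h6]
    exact (S p).le_of_opNorm_le (hM p (hpq.trans hq)) _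
  rcases le_total t a with h | h
  · rw [max_eq_right h, min_eq_left h, norm_sub_rev]
    exact h5 t a h (by simp)
  · rw [max_eq_left h, min_eq_right h]
    exact h5 a t h ht

/-- Orbits starting in the domain of the generator solve the evolution equation. -/
theorem IsSemigroupGeneratedBy.orbit_mem_graph {A : X →ₗ.[ℂ] X}
    (hS : IsSemigroupGeneratedBy S A) {x y : X} (hxy : (x, y) ∈ A.graph) (t : ℝ≥0) :
    (S t x, S t y) ∈ A.graph := by
  rw [hS.generator]
  refine (((S t).continuous.tendsto y).comp ((hS.generator x y).1 hxy)).congr fun r => ?_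
  have h1 : S r (S t x) = S t (S r x) := by
    have h2 := hS.isC0Semigroup.map_add r t
    rw [add_comm, hS.isC0Semigroup.map_add] at h2
    exact (DFunLike.congr_fun h2 x).symm
  simp [h1]

theorem IsSemigroupGeneratedBy.hasDerivWithinAt_orbit {A : X →ₗ.[ℂ] X}
    (hS : IsSemigroupGeneratedBy S A) {x y : X} (hxy : (x, y) ∈ A.graph) {a : ℝ} (ha : 0 ≤ a) :
    HasDerivWithinAt (fun r : ℝ => S r.toNNReal x) (S a.toNNReal y) (Set.Ici a) a := by
  have h1 := (hS.generator _ _).1 (hS.orbit_mem_graph hxy a.toNNReal)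
  rw [← hasDerivWithinAt_Ioi_iff_Ici, hasDerivWithinAt_iff_tendsto_slope' (by simp)]
  have h2 : Tendsto (fun r : ℝ => (r - a).toNNReal) (𝓝[>] a) (𝓝[>] 0) := by
    refine tendsto_nhdsWithin_iff.2 ⟨?_, ?_⟩
    · have h3 : Continuous fun r : ℝ => (r - a).toNNReal := by fun_prop
      have h4 := h3.tendsto a
      simp only [sub_self, Real.toNNReal_zero] at h4
      exact h4.mono_left nhdsWithin_le_nhds
    · filter_upwards [self_mem_nhdsWithin] with r hr
      simpa using hr
  refine (h1.comp h2).congr' ?_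
  filter_upwards [self_mem_nhdsWithin] with r hr
  have hr' : a < r := hr
  have h5 : S r.toNNReal x = S (r - a).toNNReal (S a.toNNReal x) := by
    have h6 : r.toNNReal = (r - a).toNNReal + a.toNNReal := by
      rw [← Real.toNNReal_add (by linarith) ha, sub_add_cancel]
    rw [h6, hS.isC0Semigroup.map_add]
    rfl
  rw [slope_def_module, Function.comp_apply, h5, Real.coe_toNNReal _ (by linarith),
    ← Complex.ofReal_inv, Complex.coe_smul]

end Uniqueness

/-! ### Uniqueness by an energy estimate -/

section Quasidissipative

variable {H : Type*} [NormedAddCommGroup H] [InnerProductSpace ℂ H] [CompleteSpace H]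

/-- A densely defined operator that is bounded above generates at most one semigroup. -/
theorem IsSemigroupGeneratedBy.unique {S S' : ℝ≥0 → H →L[ℂ] H} {A : H →ₗ.[ℂ] H}
    (hS : IsSemigroupGeneratedBy S A) (hS' : IsSemigroupGeneratedBy S' A) {M : ℝ}
    (hA : ∀ x y, (x, y) ∈ A.graph → (inner ℂ x y).re ≤ M * ‖x‖ ^ 2)
    (hdense : Dense (A.domain : Set H)) : S = S' := by
  funext t
  refine DFunLike.coe_injective (Continuous.ext_on hdense (S t).continuous (S' t).continuous ?_)
  intro x hx
  have hxy : (x, A ⟨x, hx⟩) ∈ A.graph := A.mem_graph ⟨x, hx⟩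
  set y := A ⟨x, hx⟩
  let _ : InnerProductSpace ℝ H := InnerProductSpace.rclikeToReal ℂ H
  set w : ℝ → H := fun r => S r.toNNReal x - S' r.toNNReal x with hw
  set w' : ℝ → H := fun r => S r.toNNReal y - S' r.toNNReal y
  have hcont : Continuous w :=
    ((hS.isC0Semigroup.continuous_orbit x).comp continuous_real_toNNReal).sub
      ((hS'.isC0Semigroup.continuous_orbit x).comp continuous_real_toNNReal)
  have hderiv : ∀ r ∈ Set.Ico (0 : ℝ) t,
      HasDerivWithinAt (fun r => ‖w r‖ ^ 2) (2 * inner ℝ (w r) (w' r)) (Set.Ici r) r :=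
    fun r hr => ((hS.hasDerivWithinAt_orbit hxy hr.1).sub
      (hS'.hasDerivWithinAt_orbit hxy hr.1)).norm_sq
  have hw0 : w 0 = 0 := by
    simp [hw, hS.isC0Semigroup.map_zero, hS'.isC0Semigroup.map_zero]
  have hbound : ∀ r ∈ Set.Ico (0 : ℝ) t,
      -- The graph is a subspace, so the difference of the two orbits again satisfies the evolution
      -- equation and the bound on `A` applies to it.
      2 * inner ℝ (w r) (w' r) ≤ 2 * M * ‖w r‖ ^ 2 + 0 := fun r _ => by
    have h2 : (w r, w' r) ∈ A.graph := A.graph.sub_mem (hS.orbit_mem_graph hxy r.toNNReal)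
      (hS'.orbit_mem_graph hxy r.toNNReal)
    have h3 := hA _ _ h2
    have h4 : inner ℝ (w r) (w' r) = (inner ℂ (w r) (w' r)).re := rfl
    rw [h4]
    linarith
  have h1 : ‖w t‖ ^ 2 ≤ gronwallBound 0 (2 * M) 0 (t - 0) :=
    le_gronwallBound_of_liminf_deriv_right_le (hcont.norm.pow 2).continuousOn
      (fun r hr q hq => (hderiv r hr).liminf_right_slope_le hq)
      (by simp [hw0]) hbound t ⟨t.2, le_rfl⟩
  rw [gronwallBound_ε0_δ0] at h1
  have h2 : w t = 0 := by
    have := sq_nonneg ‖w t‖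
    exact norm_eq_zero.1 (pow_eq_zero_iff two_ne_zero |>.1 (le_antisymm h1 this))
  simpa [hw, sub_eq_zero] using h2

/-- An operator whose resolvent at some `μ ≥ 0` is a nonnegative bounded operator `R` generates a
unique strongly continuous semigroup, and for positive times it factors through `R`. -/
theorem existsUnique_semigroup_of_resolvent {R : H →L[ℂ] H} {μ : ℝ} (hR : 0 ≤ R)
    (hinj : Function.Injective R) (hμ : 0 ≤ μ) {A : H →ₗ.[ℂ] H}
    (hA : ∀ x y, (x, y) ∈ A.graph ↔ R ((μ : ℂ) • x - y) = x) :
    (∃! S, IsSemigroupGeneratedBy S A) ∧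
      ∀ S, IsSemigroupGeneratedBy S A → ∀ t : ℝ≥0, 0 < t → ∃ Q : H →L[ℂ] H, S t = R.comp Q := by
  have h1 := isSemigroupGeneratedBy_resolventSemigroup hR hinj hμ hA
  have hdom : Dense (A.domain : Set H) := by
    refine (denseRange_of_nonneg_of_injective hR hinj).mono ?_
    rintro _ ⟨z, rfl⟩
    have h2 : (R z, (μ : ℂ) • R z - z) ∈ A.graph := by rw [hA, sub_sub_cancel]
    exact LinearPMap.mem_domain_of_mem_graph h2
  -- This is `0 ≤ Re ⟨R z, z⟩` at `z = μ x - y`, where `R z = x`.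
  have hbound : ∀ x y, (x, y) ∈ A.graph → (inner ℂ x y).re ≤ μ * ‖x‖ ^ 2 := by
    intro x y hxy
    rw [hA] at hxy
    have h3 := ((ContinuousLinearMap.nonneg_iff_isPositive R).1 hR).re_inner_nonneg_left
      ((μ : ℂ) • x - y)
    rw [hxy, inner_sub_right, inner_smul_right, inner_self_eq_norm_sq_to_K] at h3
    have h4 : (inner ℂ x y).re = RCLike.re (inner ℂ x y) := rfl
    rw [h4]
    rw [map_sub, sub_nonneg] at h3
    refine h3.trans (le_of_eq ?_)
    change ((μ : ℂ) * ((‖x‖ : ℝ) : ℂ) ^ 2).re = μ * ‖x‖ ^ 2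
    norm_cast
  have huniq : ∀ S, IsSemigroupGeneratedBy S A → S = resolventSemigroup R μ :=
    fun S hS => hS.unique h1 hbound hdom
  refine ⟨⟨_, h1, huniq⟩, fun S hS t ht => ?_⟩
  rw [huniq S hS]
  exact exists_resolventSemigroup_eq_comp hR ht

end Quasidissipative

end SwiftHohenberg

namespace SwiftHohenberg

open Filter

/-! ### Diagonal operators on sequences -/

/-- Square summable sequences indexed by the integers. -/
abbrev SeqL2 : Type := lp (fun _ : ℤ => ℂ) 2

theorem SeqL2.norm_sq (f : SeqL2) : ‖f‖ ^ 2 = ∑' j, ‖f j‖ ^ 2 := by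
  simpa using lp.norm_rpow_eq_tsum (p := 2) (by norm_num) f

theorem SeqL2.summable_sq (f : SeqL2) : Summable fun j => ‖f j‖ ^ 2 := by
  simpa using (lp.memℓp f).summable (by norm_num)

theorem memlp_two_of_summable {f : ℤ → ℂ} (h : Summable fun j => ‖f j‖ ^ 2) : Memℓp f 2 := by
  rw [memℓp_gen_iff (by norm_num)]
  simpa using h

theorem summable_sq_mul_of_bounded {m : ℤ → ℂ} {C : ℝ} (hm : ∀ j, ‖m j‖ ≤ C) (f : SeqL2) :
    Summable fun j => ‖m j * f j‖ ^ 2 := by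
  refine Summable.of_nonneg_of_le (fun j => by positivity) (fun j => ?_)
    ((SeqL2.summable_sq f).mul_left (C ^ 2))
  rw [norm_mul, mul_pow]
  gcongr
  exact hm j

/-- The diagonal operator with bounded entries `m`. -/
noncomputable def diagOp (m : ℤ → ℂ) (C : ℝ) (hm : ∀ j, ‖m j‖ ≤ C) : SeqL2 →L[ℂ] SeqL2 :=
  LinearMap.mkContinuous
    { toFun := fun f => ⟨fun j => m j * f j,
        memlp_two_of_summable (summable_sq_mul_of_bounded hm f)⟩
      map_add' := fun f g => by
        ext j
        simp only [lp.coeFn_add, Pi.add_apply, mul_add]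
      map_smul' := fun c f => by
        ext j
        simp only [lp.coeFn_smul, Pi.smul_apply, smul_eq_mul, RingHom.id_apply]
        ring } C (fun f => by
      have hC : 0 ≤ C := (norm_nonneg _).trans (hm 0)
      refine (pow_le_pow_iff_left₀ (norm_nonneg _) (by positivity) two_ne_zero).1 ?_
      rw [mul_pow, SeqL2.norm_sq, SeqL2.norm_sq, ← tsum_mul_left]
      refine Summable.tsum_le_tsum (fun j => ?_) (summable_sq_mul_of_bounded hm f)
        ((SeqL2.summable_sq f).mul_left (C ^ 2))
      change ‖m j * f j‖ ^ 2 ≤ _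
      rw [norm_mul, mul_pow]
      gcongr
      exact hm j)

section DiagOp

variable {m : ℤ → ℂ} {C : ℝ} (hm : ∀ j, ‖m j‖ ≤ C)

theorem diagOp_apply (f : SeqL2) (j : ℤ) : diagOp m C hm f j = m j * f j := rfl

theorem norm_diagOp_le : ‖diagOp m C hm‖ ≤ C :=
  LinearMap.mkContinuous_norm_le _ ((norm_nonneg _).trans (hm 0)) _

/-- A diagonal operator with finitely many nonzero entries is compact. -/
theorem isCompactOperator_diagOp_of_finite (s : Finset ℤ) (hs : ∀ j ∉ s, m j = 0) :
    IsCompactOperator (diagOp m C hm) := by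
  classical
  let P : SeqL2 →ₗ[ℂ] (s → ℂ) :=
    { toFun := fun f j => f j
      map_add' := fun f g => rfl
      map_smul' := fun c f => rfl }
  let P' : SeqL2 →L[ℂ] (s → ℂ) := P.mkContinuous 1 (fun f => by
    rw [one_mul, pi_norm_le_iff_of_nonneg (norm_nonneg f)]
    exact fun j => lp.norm_apply_le_norm (by norm_num) f j)
  let Q : (s → ℂ) →ₗ[ℂ] SeqL2 :=
    ∑ j : s, (LinearMap.toSpanSingleton ℂ SeqL2 (lp.single 2 (j : ℤ) (m j))).comp
      (LinearMap.proj j)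
  let Q' : (s → ℂ) →L[ℂ] SeqL2 := LinearMap.toContinuousLinearMap Q
  -- The operator factors through the finite-dimensional space of coordinates in `s`.
  have h1 : diagOp m C hm = Q'.comp P' := by
    ext f i
    have h2 : (Q (P f) : SeqL2) i = ∑ j : s, f j * (lp.single 2 (j : ℤ) (m j) : SeqL2) i := by
      simp only [Q, P, LinearMap.sum_apply, LinearMap.comp_apply, LinearMap.proj_apply,
        LinearMap.toSpanSingleton_apply, lp.coeFn_sum, Finset.sum_apply, lp.coeFn_smul,
        Pi.smul_apply, smul_eq_mul]
      rfl
    change m i * f i = (Q (P f) : SeqL2) i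
    rw [h2, Finset.sum_coe_sort s fun j => f j * (lp.single 2 j (m j) : SeqL2) i]
    by_cases hi : i ∈ s
    · rw [Finset.sum_eq_single_of_mem i hi]
      · rw [lp.single_apply_self, mul_comm]
      · intro j _ hj
        rw [lp.single_apply_ne _ _ _ hj.symm, mul_zero]
    · rw [hs i hi, zero_mul, Finset.sum_eq_zero]
      intro j hj
      rw [lp.single_apply_ne _ _ _ (by rintro rfl; exact hi hj), mul_zero]
  rw [h1]
  have h3 : IsCompactOperator (_root_.id : (s → ℂ) → (s → ℂ)) :=
    (isCompactOperator_id_iff_finiteDimensional (𝕜 := ℂ) (E := s → ℂ)).2 inferInstance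
  exact (h3.comp_clm P').clm_comp Q'

/-- A diagonal operator whose entries tend to zero is compact. -/
theorem isCompactOperator_diagOp (h0 : Tendsto m cofinite (𝓝 0)) :
    IsCompactOperator (diagOp m C hm) := by
  classical
  have hC : 0 ≤ C := (norm_nonneg _).trans (hm 0)
  have hcut : ∀ (s : Finset ℤ) (j : ℤ), ‖if j ∈ s then m j else 0‖ ≤ C := fun s j => by
    split_ifs
    · exact hm j
    · simpa using hC
  refine isCompactOperator_of_tendsto (l := (atTop : Filter (Finset ℤ)))
    (F := fun s => diagOp (fun j => if j ∈ s then m j else 0) C (hcut s)) ?_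
    (Eventually.of_forall fun s => isCompactOperator_diagOp_of_finite _ s fun j hj => if_neg hj)
  rw [Metric.tendsto_nhds]
  intro e he
  have h1 : {j | ¬ ‖m j‖ < e / 2}.Finite := by
    have := (Metric.tendsto_nhds.1 h0) (e / 2) (by positivity)
    simpa only [dist_zero_right] using eventually_cofinite.1 this
  filter_upwards [eventually_ge_atTop h1.toFinset] with s hs
  have h2 : ∀ j, ‖(if j ∈ s then m j else 0) - m j‖ ≤ e / 2 := fun j => by
    split_ifs with hj
    · simp only [sub_self, norm_zero]
      positivity
    · rw [zero_sub, norm_neg]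
      by_contra hcon
      exact hj (hs (by simpa using (not_le.1 hcon).le))
  have h3 : diagOp (fun j => if j ∈ s then m j else 0) C (hcut s) - diagOp m C hm
      = diagOp _ (e / 2) h2 := by
    ext f j
    change (if j ∈ s then m j else 0) * f j - m j * f j
      = ((if j ∈ s then m j else 0) - m j) * f j
    ring
  rw [dist_eq_norm, h3]
  exact (norm_diagOp_le h2).trans_lt (by linarith)

end DiagOp

/-! ### Fourier coefficients -/

/-- The `L²` function with given square summable Fourier coefficients. -/
noncomputable def ofCoeff (f : SeqL2) : L2T := (fourierBasis (T := 2 * Real.pi)).repr.symm f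

theorem coeff_ofCoeff (f : SeqL2) (j : ℤ) : coeff (ofCoeff f) j = f j := by
  rw [coeff_eq_repr, ofCoeff, LinearIsometryEquiv.apply_symm_apply]

/-- The weights are at least `1`, so dividing by them is a bounded diagonal operator. -/
theorem HSobolev.weighted_surjective (p : ℕ) :
    Function.Surjective (HSobolev.weighted (p := p)) := by
  intro f
  set c : ℤ → ℝ := fun j => Real.sqrt ((1 + (j : ℝ) ^ 2) ^ p) with hc
  have hc1 : ∀ j, 1 ≤ c j := fun j => by
    rw [hc, Real.one_le_sqrt]
    exact one_le_pow₀ (by nlinarith [sq_nonneg (j : ℝ)])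
  have hcinv : ∀ j, ‖((c j : ℂ))⁻¹‖ ≤ 1 := fun j => by
    rw [norm_inv, Complex.norm_real, Real.norm_of_nonneg (by linarith [hc1 j])]
    exact inv_le_one_of_one_le₀ (hc1 j)
  set g : L2T := ofCoeff (diagOp _ 1 hcinv f) with hg
  have hcoeff : ∀ j, (c j : ℂ) * coeff g j = f j := fun j => by
    have : (c j : ℂ) ≠ 0 := by exact_mod_cast (by linarith [hc1 j] : c j ≠ 0)
    rw [hg, coeff_ofCoeff, diagOp_apply, mul_inv_cancel_left₀ this]
  have hmem : g ∈ sobolev p := by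
    rw [mem_sobolev_iff]
    refine (SeqL2.summable_sq f).congr fun j => ?_
    rw [← hcoeff j, norm_mul, mul_pow, Complex.norm_real, Real.norm_eq_abs, sq_abs,
      Real.sq_sqrt (by positivity)]
  refine ⟨(⟨g, hmem⟩ : sobolev p), ?_⟩
  ext j
  exact hcoeff j

/-- The weighted Fourier coefficients identify the Sobolev space with `ℓ²`. -/
noncomputable def HSobolev.weightedEquiv (p : ℕ) : HSobolev p ≃ₗᵢ[ℂ] SeqL2 :=
  LinearIsometryEquiv.ofSurjective ⟨HSobolev.weighted, fun _ => rfl⟩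
    (HSobolev.weighted_surjective p)

theorem HSobolev.weightedEquiv_apply {p : ℕ} (w : HSobolev p) (j : ℤ) :
    HSobolev.weightedEquiv p w j
      = (Real.sqrt ((1 + (j : ℝ) ^ 2) ^ p) : ℂ) * coeff (HSobolev.toL2 w) j := rfl

theorem HSobolev.norm_toL2_le {p : ℕ} (w : HSobolev p) : ‖HSobolev.toL2 w‖ ≤ ‖w‖ := by
  refine (pow_le_pow_iff_left₀ (norm_nonneg _) (norm_nonneg _) two_ne_zero).1 ?_
  have h0 : ‖HSobolev.toL2 w‖ = ‖(fourierBasis (T := 2 * Real.pi)).repr (HSobolev.toL2 w)‖ :=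
    ((fourierBasis (T := 2 * Real.pi)).repr.norm_map _).symm
  rw [HSobolev.norm_sq, h0, SeqL2.norm_sq]
  refine Summable.tsum_le_tsum (fun j => ?_) (SeqL2.summable_sq _)
    (mem_sobolev_iff.1 (HSobolev.toL2_mem w))
  rw [← coeff_eq_repr]
  exact le_mul_of_one_le_left (by positivity)
    (one_le_pow₀ (by nlinarith [sq_nonneg (j : ℝ)]))

/-- The inclusion of the Sobolev space into `L²`, as a bounded operator. -/
noncomputable def HSobolev.toL2CLM (p : ℕ) : HSobolev p →L[ℂ] L2T :=
  LinearMap.mkContinuous HSobolev.toL2 1 fun w => by simpa using norm_toL2_le w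

/-- A Fourier multiplier on `L²`. -/
noncomputable def multiplier (m : ℤ → ℂ) (C : ℝ) (hm : ∀ j, ‖m j‖ ≤ C) : L2T →L[ℂ] L2T :=
  ((fourierBasis (T := 2 * Real.pi)).repr.symm.toContinuousLinearEquiv : SeqL2 →L[ℂ] L2T).comp
    ((diagOp m C hm).comp
      ((fourierBasis (T := 2 * Real.pi)).repr.toContinuousLinearEquiv : L2T →L[ℂ] SeqL2))

theorem coeff_multiplier {m : ℤ → ℂ} {C : ℝ} (hm : ∀ j, ‖m j‖ ≤ C) (f : L2T) (j : ℤ) :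
    coeff (multiplier m C hm f) j = m j * coeff f j := by
  rw [coeff_eq_repr f]
  exact coeff_ofCoeff (diagOp m C hm ((fourierBasis (T := 2 * Real.pi)).repr f)) j

theorem norm_multiplier_le {m : ℤ → ℂ} {C : ℝ} (hm : ∀ j, ‖m j‖ ≤ C) :
    ‖multiplier m C hm‖ ≤ C := by
  have hC : 0 ≤ C := (norm_nonneg _).trans (hm 0)
  refine ContinuousLinearMap.opNorm_le_bound _ hC fun f => ?_
  have h1 : ‖multiplier m C hm f‖
      = ‖diagOp m C hm ((fourierBasis (T := 2 * Real.pi)).repr f)‖ :=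
    (fourierBasis (T := 2 * Real.pi)).repr.symm.norm_map _
  rw [h1, ← (fourierBasis (T := 2 * Real.pi)).repr.norm_map f]
  exact (diagOp m C hm).le_of_opNorm_le (norm_diagOp_le hm) _

theorem hasSum_inner_coeff (f g : L2T) :
    HasSum (fun j => (starRingEnd ℂ) (coeff f j) * coeff g j) (inner ℂ f g) := by
  have h := lp.hasSum_inner (𝕜 := ℂ) ((fourierBasis (T := 2 * Real.pi)).repr f)
    ((fourierBasis (T := 2 * Real.pi)).repr g)
  rw [LinearIsometryEquiv.inner_map_map] at h
  refine h.congr_fun fun j => ?_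
  rw [coeff_eq_repr, coeff_eq_repr, RCLike.inner_apply, mul_comm]

/-- Under the isometries of `L²` and `H^p` with `ℓ²`, the multiplier becomes diagonal with the
weighted entries, which tend to zero. -/
theorem exists_compact_of_multiplier {m : ℤ → ℂ} {C : ℝ} (hm : ∀ j, ‖m j‖ ≤ C) {p : ℕ}
    (hsmooth : ∀ j : ℤ, ‖(Real.sqrt ((1 + (j : ℝ) ^ 2) ^ p) : ℂ) * m j‖ ≤ C)
    (h0 : Tendsto (fun j : ℤ => (Real.sqrt ((1 + (j : ℝ) ^ 2) ^ p) : ℂ) * m j) cofinite (𝓝 0)) :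
    ∃ D : L2T →L[ℂ] HSobolev p, (∀ f, HSobolev.toL2 (D f) = multiplier m C hm f) ∧
      IsCompactOperator D := by
  let E : SeqL2 →L[ℂ] HSobolev p :=
    ((HSobolev.weightedEquiv p).symm.toContinuousLinearEquiv : SeqL2 →L[ℂ] HSobolev p)
  let F : L2T →L[ℂ] SeqL2 :=
    ((fourierBasis (T := 2 * Real.pi)).repr.toContinuousLinearEquiv : L2T →L[ℂ] SeqL2)
  refine ⟨E.comp ((diagOp _ C hsmooth).comp F), fun f => coeff_injective fun j => ?_,
    ((isCompactOperator_diagOp hsmooth h0).comp_clm F).clm_comp E⟩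
  have h1 : (HSobolev.weightedEquiv p (E.comp ((diagOp _ C hsmooth).comp F) f))
      = diagOp _ C hsmooth (F f) := (HSobolev.weightedEquiv p).apply_symm_apply _
  have h2 := congrArg (fun g : SeqL2 => g j) h1
  simp only [HSobolev.weightedEquiv_apply, diagOp_apply] at h2
  rw [mul_assoc] at h2
  have h3 : (Real.sqrt ((1 + (j : ℝ) ^ 2) ^ p) : ℂ) ≠ 0 := by
    have : (0 : ℝ) < (1 + (j : ℝ) ^ 2) ^ p := by positivity
    exact_mod_cast (Real.sqrt_pos.2 this).ne'
  rw [mul_left_cancel₀ h3 h2, coeff_multiplier, coeff_eq_repr]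
  rfl

end SwiftHohenberg

namespace SwiftHohenberg

open MeasureTheory Filter

/-! ### Bounded perturbations of resolvents -/

/-- If `R₀ = (μ - A)⁻¹` with `A` self-adjoint and nonpositive and `V` is bounded and self-adjoint
with `‖V‖ < μ`, then `(μ - A - V)⁻¹` is nonnegative and factors through `R₀`. -/
theorem exists_perturbed_resolvent {H : Type*} [NormedAddCommGroup H] [InnerProductSpace ℂ H]
    [CompleteSpace H] {μ : ℝ} (hμ : 0 < μ) {R₀ V : H →L[ℂ] H} (hR₀ : ‖R₀‖ ≤ μ⁻¹)
    (hinj : Function.Injective R₀)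
    (hbound : ∀ g, ((inner ℂ (R₀ g) g).re : ℂ) = inner ℂ (R₀ g) g ∧
      μ * ‖R₀ g‖ ^ 2 ≤ (inner ℂ (R₀ g) g).re)
    (hV : IsSelfAdjoint V) (hμV : ‖V‖ < μ) :
    ∃ R Q : H →L[ℂ] H, 0 ≤ R ∧ Function.Injective R ∧
      (∀ y x, R y = x ↔ R₀ (y + V x) = x) ∧ R = R₀.comp Q := by
  have hnorm : ‖V * R₀‖ < 1 := by
    refine (norm_mul_le _ _).trans_lt ?_
    calc ‖V‖ * ‖R₀‖ ≤ ‖V‖ * μ⁻¹ := by gcongr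
      _ < μ * μ⁻¹ := by gcongr
      _ = 1 := mul_inv_cancel₀ hμ.ne'
  set U := Units.oneSub (V * R₀) hnorm
  have hUval : ∀ z, (U : H →L[ℂ] H) z = z - V (R₀ z) := fun z => rfl
  have hUinv : ∀ z, (U : H →L[ℂ] H) ((↑U⁻¹ : H →L[ℂ] H) z) = z :=
    fun z => DFunLike.congr_fun U.mul_inv z
  have hinvU : ∀ z, (↑U⁻¹ : H →L[ℂ] H) ((U : H →L[ℂ] H) z) = z :=
    fun z => DFunLike.congr_fun U.inv_mul z
  have key : ∀ y x, (R₀.comp (↑U⁻¹ : H →L[ℂ] H)) y = x ↔ R₀ (y + V x) = x := by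
    intro y x
    constructor
    · rintro rfl
      have h1 := hUinv y
      rw [hUval, sub_eq_iff_eq_add] at h1
      rw [ContinuousLinearMap.comp_apply, ← h1]
    · intro h
      have h1 : (U : H →L[ℂ] H) (y + V x) = y := by rw [hUval, h, add_sub_cancel_right]
      rw [ContinuousLinearMap.comp_apply, ← h, ← hinvU (y + V x), h1]
  refine ⟨R₀.comp (↑U⁻¹ : H →L[ℂ] H), (↑U⁻¹ : H →L[ℂ] H), ?_, ?_, key, rfl⟩
  -- With `x = R y` and `g = y + V x` one has `x = R₀ g`, so `⟨x, y⟩ = ⟨R₀ g, g⟩ - ⟨x, V x⟩`. Both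
  -- terms are real, the first at least `μ ‖x‖²` and the second at most `‖V‖ ‖x‖²`.
  · rw [ContinuousLinearMap.nonneg_iff_isPositive, ContinuousLinearMap.isPositive_iff_complex]
    intro y
    set x := (R₀.comp (↑U⁻¹ : H →L[ℂ] H)) y with hx
    have h1 := (key y x).1 hx.symm
    obtain ⟨h2, h3⟩ := hbound (y + V x)
    rw [h1] at h2 h3
    have h4 : inner ℂ x y = inner ℂ x (y + V x) - inner ℂ x (V x) := by
      rw [inner_add_right, add_sub_cancel_right]
    have h5 : ((inner ℂ x (V x)).re : ℂ) = inner ℂ x (V x) := by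
      rw [← Complex.conj_eq_iff_re, inner_conj_symm]
      exact hV.isSymmetric x x
    have h6 : (inner ℂ x (V x)).re ≤ ‖V‖ * ‖x‖ ^ 2 :=
      calc (inner ℂ x (V x)).re ≤ ‖inner ℂ x (V x)‖ := Complex.re_le_norm _
        _ ≤ ‖x‖ * ‖V x‖ := norm_inner_le_norm _ _
        _ ≤ ‖x‖ * (‖V‖ * ‖x‖) := by gcongr; exact V.le_opNorm x
        _ = ‖V‖ * ‖x‖ ^ 2 := by ring
    rw [h4]
    constructor
    · rw [← h2, ← h5, ← Complex.ofReal_sub]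
      rfl
    · have h7 : ‖V‖ * ‖x‖ ^ 2 ≤ μ * ‖x‖ ^ 2 := by gcongr
      change 0 ≤ (inner ℂ x (y + V x) - inner ℂ x (V x)).re
      rw [Complex.sub_re]
      linarith
  · rw [injective_iff_map_eq_zero]
    intro y hy
    have h1 := (key y 0).1 hy
    rw [map_zero, add_zero] at h1
    exact (injective_iff_map_eq_zero R₀).1 hinj y h1

/-! ### Resolvents of Fourier multipliers -/

theorem norm_inv_symbol_le {μ : ℝ} (hμ : 0 < μ) (m : ℤ → ℝ) (j : ℤ) :
    ‖((μ + m j ^ 2 : ℝ) : ℂ)⁻¹‖ ≤ μ⁻¹ := by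
  rw [norm_inv, Complex.norm_real, Real.norm_of_nonneg (by positivity)]
  gcongr
  nlinarith [sq_nonneg (m j)]

/-- The resolvent `(μ - A)⁻¹` of the Fourier multiplier `A` with symbol `-m²`. -/
noncomputable def freeResolvent {μ : ℝ} (hμ : 0 < μ) (m : ℤ → ℝ) : L2T →L[ℂ] L2T :=
  multiplier (fun j => ((μ + m j ^ 2 : ℝ) : ℂ)⁻¹) μ⁻¹ (norm_inv_symbol_le hμ m)

section Resolvent

variable {μ : ℝ} (hμ : 0 < μ) (m : ℤ → ℝ)

theorem symbol_ne_zero {μ : ℝ} (hμ : 0 < μ) (m : ℤ → ℝ) (j : ℤ) :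
    ((μ + m j ^ 2 : ℝ) : ℂ) ≠ 0 := by
  have : 0 < μ + m j ^ 2 := by positivity
  exact_mod_cast this.ne'

theorem freeResolvent_apply_eq_iff (g x : L2T) :
    freeResolvent hμ m g = x ↔ ∀ j, ((μ + m j ^ 2 : ℝ) : ℂ) * coeff x j = coeff g j := by
  constructor
  · rintro rfl j
    rw [freeResolvent, coeff_multiplier, mul_inv_cancel_left₀ (symbol_ne_zero hμ m j)]
  · intro h
    refine coeff_injective fun j => ?_
    rw [freeResolvent, coeff_multiplier, ← h j, inv_mul_cancel_left₀ (symbol_ne_zero hμ m j)]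

/-- With `x = R₀ g`, Parseval gives `⟨x, g⟩ = ∑ (μ + m j²) |x̂ j|²`. -/
theorem le_inner_freeResolvent (g : L2T) :
    ((inner ℂ (freeResolvent hμ m g) g).re : ℂ) = inner ℂ (freeResolvent hμ m g) g ∧
      μ * ‖freeResolvent hμ m g‖ ^ 2 ≤ (inner ℂ (freeResolvent hμ m g) g).re := by
  set x := freeResolvent hμ m g with hx
  have h1 := (freeResolvent_apply_eq_iff hμ m g x).1 hx.symm
  have h2 : HasSum (fun j => (((μ + m j ^ 2) * ‖coeff x j‖ ^ 2 : ℝ) : ℂ)) (inner ℂ x g) := by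
    refine (hasSum_inner_coeff x g).congr_fun fun j => ?_
    rw [← h1 j, mul_left_comm, Complex.conj_mul']
    push_cast
    ring
  have h3 := Complex.hasSum_re h2
  have h4 : HasSum (fun j => ‖coeff x j‖ ^ 2) (‖x‖ ^ 2) := by
    have h5 := Complex.hasSum_re (hasSum_inner_coeff x x)
    rw [inner_self_eq_norm_sq_to_K] at h5
    convert h5 using 1
    · ext j
      rw [Complex.conj_mul']
      norm_cast
    · norm_cast
  refine ⟨?_, hasSum_le (fun j => ?_) (h4.mul_left μ) h3⟩
  · have h5 := Complex.hasSum_im h2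
    simp only [Complex.ofReal_im] at h5
    have h6 := h5.unique hasSum_zero
    apply Complex.ext
    · simp
    · simp [h6]
  · rw [Complex.ofReal_re]
    gcongr
    nlinarith [sq_nonneg (m j)]

theorem injective_freeResolvent : Function.Injective (freeResolvent hμ m) := by
  rw [injective_iff_map_eq_zero]
  intro y hy
  rw [freeResolvent_apply_eq_iff] at hy
  refine coeff_injective fun j => ?_
  rw [← hy j, coeff_zero, mul_zero]

end Resolvent

/-! ### The Bloch operator -/

theorem isSelfAdjoint_mulOp {F : C(Torus, ℂ)} (hF : ∀ x, (starRingEnd ℂ) (F x) = F x) :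
    IsSelfAdjoint (mulOp F) := by
  rw [ContinuousLinearMap.isSelfAdjoint_iff_isSymmetric]
  intro f g
  change inner ℂ (mulOp F f) g = inner ℂ f (mulOp F g)
  rw [L2.inner_def, L2.inner_def]
  refine integral_congr_ae ?_
  filter_upwards [coeFn_mulOp F f, coeFn_mulOp F g] with x h1 h2
  rw [h1, h2, RCLike.inner_apply, RCLike.inner_apply, map_mul, hF]
  ring

theorem Roll.conj_potential {ε ω b s : ℝ} (u : Roll ε ω b s) (x : Torus) :
    (starRingEnd ℂ) (u.potential x) = u.potential x := by
  induction x using QuotientAddGroup.induction_on with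
  | H x => exact Complex.conj_ofReal _

/-- The Fourier symbol of `1 + (1 + 2 ε ω) (∂ₓ + i σ₁)² - σ₂²`. -/
def blochSymbol (ε ω : ℝ) (σ : ℝ × ℝ) (j : ℤ) : ℝ :=
  1 - (1 + 2 * ε * ω) * (j + σ.1) ^ 2 - σ.2 ^ 2

theorem coeff_neg (f : L2T) (j : ℤ) : coeff (-f) j = -coeff f j := by
  simp [coeff_eq_repr]

theorem coeff_sub (f g : L2T) (j : ℤ) : coeff (f - g) j = coeff f j - coeff g j := by
  simp [coeff_eq_repr]

theorem coeff_covDeriv (σ₁ : ℝ) (p : ℕ) (u : sobolev (p + 1)) (j : ℤ) :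
    coeff (covDeriv σ₁ p u : L2T) j = Complex.I * (j + σ₁) * coeff (u : L2T) j := by
  have h1 : (covDeriv σ₁ p u : L2T) = derivL2 u + (Complex.I * (σ₁ : ℂ)) • (u : L2T) := rfl
  rw [h1, coeff_add, coeff_derivL2, coeff_smul]
  ring

theorem coeff_blochRoot (ε ω : ℝ) (σ : ℝ × ℝ) (p : ℕ) (u : sobolev (p + 2)) (j : ℤ) :
    coeff (blochRoot ε ω σ p u : L2T) j = blochSymbol ε ω σ j * coeff (u : L2T) j := by
  have h1 : (blochRoot ε ω σ p u : L2T) = (u : L2T)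
      + ((1 + 2 * ε * ω : ℝ) : ℂ) • (covDeriv σ.1 p (covDeriv σ.1 (p + 1) u) : L2T)
      - ((σ.2 ^ 2 : ℝ) : ℂ) • (u : L2T) := rfl
  rw [h1, coeff_sub, coeff_add, coeff_smul, coeff_smul, coeff_covDeriv, coeff_covDeriv,
    blochSymbol]
  push_cast
  linear_combination
    (1 + 2 * (ε : ℂ) * ω) * (j + σ.1) ^ 2 * coeff (u : L2T) j * Complex.I_sq

theorem mem_graph_blochOperator_iff {ε ω b s : ℝ} (u : Roll ε ω b s) (σ : ℝ × ℝ) (x y : L2T) :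
    (x, y) ∈ (blochOperator u σ).graph ↔ x ∈ sobolev 4 ∧ ∀ j, coeff y j =
      -(blochSymbol ε ω σ j : ℂ) ^ 2 * coeff x j + coeff (mulOp u.potential x) j := by
  have h1 : ∀ w : sobolev 4, ∀ j, coeff (blochOperator u σ w) j =
      -(blochSymbol ε ω σ j : ℂ) ^ 2 * coeff (w : L2T) j
        + coeff (mulOp u.potential (w : L2T)) j := by
    intro w j
    have h2 : blochOperator u σ w = -(blochRoot ε ω σ 0 (blochRoot ε ω σ 2 w) : L2T)
        + mulOp u.potential (w : L2T) := rfl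
    rw [h2, coeff_add, coeff_neg, coeff_blochRoot, coeff_blochRoot]
    ring
  rw [LinearPMap.mem_graph_iff]
  constructor
  · rintro ⟨w, rfl, rfl⟩
    exact ⟨w.2, h1 w⟩
  · rintro ⟨hx, hy⟩
    exact ⟨⟨x, hx⟩, rfl, coeff_injective fun j => (h1 ⟨x, hx⟩ j).trans (hy j).symm⟩

/-- Ellipticity: since `1 + 2 ε ω > 0`, the symbol grows quadratically in `j`. All regularity gained
by the resolvent comes from here. -/
theorem exists_sq_le_blochSymbol {ε ω : ℝ} (hk : 0 < 1 + 2 * ε * ω) (σ : ℝ × ℝ) {μ : ℝ}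
    (hμ : 0 < μ) :
    ∃ C : ℝ, 0 < C ∧ ∀ j : ℤ, (1 + (j : ℝ) ^ 2) ^ 2 ≤ C * (μ + blochSymbol ε ω σ j ^ 2) := by
  set k := 1 + 2 * ε * ω with hkdef
  set α := 1 + 2 * σ.1 ^ 2 + 2 / k with hα
  refine ⟨2 * α ^ 2 / μ + 2 * (2 / k) ^ 2, by positivity, fun j => ?_⟩
  set m := blochSymbol ε ω σ j with hm
  have h1 : (j + σ.1) ^ 2 = (1 - σ.2 ^ 2 - m) / k := by
    rw [hm, blochSymbol, ← hkdef]
    field_simp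
    ring
  -- Uses `j² ≤ 2 (j + σ₁)² + 2 σ₁²`, whose defect is the square `(j + 2 σ₁)²`.
  have h2 : 1 + (j : ℝ) ^ 2 ≤ α + 2 / k * |m| := by
    have h3 : (j + σ.1) ^ 2 ≤ (1 + |m|) / k := by
      rw [h1]
      gcongr
      linarith [neg_abs_le m, sq_nonneg σ.2]
    have h4 : (2 : ℝ) * ((1 + |m|) / k) = 2 / k + 2 / k * |m| := by ring
    nlinarith [sq_nonneg ((j : ℝ) + 2 * σ.1)]
  calc (1 + (j : ℝ) ^ 2) ^ 2 ≤ (α + 2 / k * |m|) ^ 2 := by gcongr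
    _ ≤ 2 * α ^ 2 + 2 * (2 / k * |m|) ^ 2 := by
      nlinarith [sq_nonneg (α - 2 / k * |m|)]
    _ = 2 * α ^ 2 / μ * μ + 2 * (2 / k) ^ 2 * m ^ 2 := by
      rw [mul_pow, sq_abs, div_mul_cancel₀ _ hμ.ne']
      ring
    _ ≤ (2 * α ^ 2 / μ + 2 * (2 / k) ^ 2) * (μ + m ^ 2) := by
      have h5 : 0 ≤ 2 * α ^ 2 / μ * m ^ 2 := by positivity
      have h6 : 0 ≤ 2 * (2 / k) ^ 2 * μ := by positivity
      linarith

section Bloch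

variable {ε ω : ℝ} (hk : 0 < 1 + 2 * ε * ω) (σ : ℝ × ℝ) {μ : ℝ} (hμ : 0 < μ)
include hk

theorem freeResolvent_mem_sobolev (g : L2T) :
    freeResolvent hμ (blochSymbol ε ω σ) g ∈ sobolev 4 := by
  obtain ⟨C, hC0, hC⟩ := exists_sq_le_blochSymbol hk σ hμ
  have h1 := (freeResolvent_apply_eq_iff hμ (blochSymbol ε ω σ) g _).1 rfl
  set x := freeResolvent hμ (blochSymbol ε ω σ) g
  rw [mem_sobolev_iff]
  have h2 := SeqL2.summable_sq ((fourierBasis (T := 2 * Real.pi)).repr g)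
  refine Summable.of_nonneg_of_le (fun j => by positivity) (fun j => ?_) (h2.mul_left (C ^ 2))
  rw [← coeff_eq_repr, ← h1 j, norm_mul, mul_pow, Complex.norm_real, Real.norm_eq_abs, sq_abs,
    ← mul_assoc, ← mul_pow]
  gcongr
  calc (1 + (j : ℝ) ^ 2) ^ 4 = ((1 + (j : ℝ) ^ 2) ^ 2) ^ 2 := by ring
    _ ≤ (C * (μ + blochSymbol ε ω σ j ^ 2)) ^ 2 := by gcongr; exact hC j

/-- The resolvent gains four derivatives and `H²` uses only two; the spare decay `(1 + j²)⁻¹` gives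
compactness. -/
theorem exists_compact_freeResolvent :
    ∃ D : L2T →L[ℂ] HSobolev 2,
      (∀ f, HSobolev.toL2 (D f) = freeResolvent hμ (blochSymbol ε ω σ) f) ∧
      IsCompactOperator D := by
  obtain ⟨C, hC0, hC⟩ := exists_sq_le_blochSymbol hk σ hμ
  have hbound : ∀ j : ℤ, ‖(Real.sqrt ((1 + (j : ℝ) ^ 2) ^ 2) : ℂ)
      * ((μ + blochSymbol ε ω σ j ^ 2 : ℝ) : ℂ)⁻¹‖ ≤ C * (1 + (j : ℝ) ^ 2)⁻¹ := fun j => by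
    have h1 : 0 < μ + blochSymbol ε ω σ j ^ 2 := by positivity
    rw [Real.sqrt_sq (by positivity), norm_mul, norm_inv, Complex.norm_real, Complex.norm_real,
      Real.norm_of_nonneg (by positivity), Real.norm_of_nonneg h1.le, ← div_eq_mul_inv,
      ← div_eq_mul_inv, div_le_div_iff₀ h1 (by positivity), ← sq]
    exact hC j
  have hlim : Tendsto (fun j : ℤ => C * (1 + (j : ℝ) ^ 2)⁻¹) cofinite (𝓝 0) := by
    have h1 : Tendsto (fun j : ℤ => (1 + (j : ℝ) ^ 2)) cofinite atTop := by
      have h2 : Tendsto (fun j : ℤ => |(j : ℝ)|) cofinite atTop := by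
        exact tendsto_norm_cocompact_atTop.comp Int.tendsto_coe_cofinite
      refine tendsto_atTop_add_const_left _ _ ?_
      refine ((tendsto_pow_atTop two_ne_zero).comp h2).congr fun j => ?_
      simp
    simpa using h1.inv_tendsto_atTop.const_mul C
  obtain ⟨D, hD, hDc⟩ := exists_compact_of_multiplier
    (m := fun j => ((μ + blochSymbol ε ω σ j ^ 2 : ℝ) : ℂ)⁻¹) (C := max μ⁻¹ C) (p := 2)
    (fun j => (norm_inv_symbol_le hμ _ j).trans (le_max_left _ _))
    (fun j => (hbound j).trans (le_max_of_le_right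
      (mul_le_of_le_one_right hC0.le (inv_le_one_of_one_le₀ (by nlinarith [sq_nonneg (j : ℝ)])))))
    (squeeze_zero_norm hbound hlim)
  refine ⟨D, fun f => ?_, hDc⟩
  rw [hD]
  exact coeff_injective fun j => by rw [coeff_multiplier, freeResolvent, coeff_multiplier]

end Bloch

end SwiftHohenberg

/-! ### Conclusion for the Bloch operator -/

theorem lemma3p1 (ε ω b s : ℝ) (hk : 0 < 1 + 2 * ε * ω)
    (u : SwiftHohenberg.Roll ε ω b s) (σ : ℝ × ℝ) :
    (∃! S : ℝ≥0 → SwiftHohenberg.L2T →L[ℂ] SwiftHohenberg.L2T,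
      SwiftHohenberg.IsSemigroupGeneratedBy S (SwiftHohenberg.blochOperator u σ)) ∧
    ∀ S : ℝ≥0 → SwiftHohenberg.L2T →L[ℂ] SwiftHohenberg.L2T,
      SwiftHohenberg.IsSemigroupGeneratedBy S (SwiftHohenberg.blochOperator u σ) →
      ∀ T : ℝ≥0, 0 < T →
        ∃ K : SwiftHohenberg.HSobolev 2 →L[ℂ] SwiftHohenberg.HSobolev 2,
          (∀ w : SwiftHohenberg.HSobolev 2,
            SwiftHohenberg.HSobolev.toL2 (K w) = S T (SwiftHohenberg.HSobolev.toL2 w)) ∧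
          IsCompactOperator K := by
  have hμ : 0 < ‖SwiftHohenberg.mulOp u.potential‖ + 1 := by positivity
  set μ : ℝ := ‖SwiftHohenberg.mulOp u.potential‖ + 1
  obtain ⟨R, P, hR, hinj, hRiff, hRP⟩ := SwiftHohenberg.exists_perturbed_resolvent hμ
    (R₀ := SwiftHohenberg.freeResolvent hμ (SwiftHohenberg.blochSymbol ε ω σ))
    (SwiftHohenberg.norm_multiplier_le _)
    (SwiftHohenberg.injective_freeResolvent hμ (SwiftHohenberg.blochSymbol ε ω σ))
    (SwiftHohenberg.le_inner_freeResolvent hμ _)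
    (SwiftHohenberg.isSelfAdjoint_mulOp u.conj_potential) (lt_add_one _)
  have hgraph : ∀ x y, (x, y) ∈ (SwiftHohenberg.blochOperator u σ).graph ↔
      R ((μ : ℂ) • x - y) = x := by
    intro x y
    rw [hRiff, SwiftHohenberg.mem_graph_blochOperator_iff]
    have hcoeff : SwiftHohenberg.freeResolvent hμ (SwiftHohenberg.blochSymbol ε ω σ)
          ((μ : ℂ) • x - y + SwiftHohenberg.mulOp u.potential x) = x ↔
        ∀ j, SwiftHohenberg.coeff y j =
          -(SwiftHohenberg.blochSymbol ε ω σ j : ℂ) ^ 2 * SwiftHohenberg.coeff x j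
            + SwiftHohenberg.coeff (SwiftHohenberg.mulOp u.potential x) j := by
      rw [SwiftHohenberg.freeResolvent_apply_eq_iff]
      refine forall_congr' fun j => ?_
      rw [SwiftHohenberg.coeff_add, SwiftHohenberg.coeff_sub, SwiftHohenberg.coeff_smul]
      push_cast
      constructor
      · intro h
        linear_combination h
      · intro h
        linear_combination h
    -- The domain condition is automatic: a solution of the resolvent equation is in the range of
    -- `R₀`, hence in `H⁴`.
    rw [← hcoeff, and_iff_right_iff_imp]
    intro h
    rw [← h]
    exact SwiftHohenberg.freeResolvent_mem_sobolev hk σ hμ _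
  obtain ⟨hexists, hfactor⟩ :=
    SwiftHohenberg.existsUnique_semigroup_of_resolvent hR hinj hμ.le hgraph
  refine ⟨hexists, fun S hS T hT => ?_⟩
  obtain ⟨Q, hQ⟩ := hfactor S hS T hT
  obtain ⟨D, hD, hDc⟩ := SwiftHohenberg.exists_compact_freeResolvent hk σ hμ
  -- In `S T = R₀ P Q` the outer factor `R₀` is replaced by its compact version `D` with values in
  -- `H²`.
  refine ⟨D.comp ((P.comp Q).comp (SwiftHohenberg.HSobolev.toL2CLM 2)), fun w => ?_,
    hDc.comp_clm _⟩
  rw [hQ, hRP]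
  exact hD _
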